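/- Let $n\in\mathbb N$, let $p\in[1,2]$, and let $f:\mathbb R^n\to\mathbb C$ be a smooth ($C^\infty$) function. Write $\Delta=\sum_{j=1}^n \partial^2/\partial x_j^2$ for the Laplacian on $\mathbb R^n$, $\Delta^m$ for its $m$-th iterate, and $\|\cdot\|_p$ for the norm of $L^p(\mathbb R^n)$ with respect to Lebesgue measure. Suppose that $\Delta^m f\in L^p(\mathbb R^n)$ for every integer $m\ge 0$, and that $$\sum_{m=1}^{\infty}\|\Delta^m f\|_p^{-\frac1{2m}}=\infty,$$ where a term with $\|\Delta^m f\|_p=0$ is read as $+\infty$. If there is a point $x_0\in\mathbb R^n$ at which $f$ and all its partial derivatives $$\partial^\alpha f=\frac{\partial^{\alpha_1+\cdots+\alpha_n}f}{\partial x_1^{\alpha_1}\cdots\partial x_n^{\alpha_n}},\qquad \alpha=(\alpha_1,\dots,\alpha_n),\ \alpha_j\in\{0,1,2,\dots\},$$ vanish, then $f(x)=0$ for every $x\in\mathbb R^n$. -/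

import Mathlib

open MeasureTheory
open scoped ENNReal ContDiff

/-- The partial derivative `∂f/∂x_j` of a function on `ℝⁿ`, as an operator on functions. -/
noncomputable def partialDeriv {n : ℕ} (j : Fin n) (f : EuclideanSpace ℝ (Fin n) → ℂ) :
    EuclideanSpace ℝ (Fin n) → ℂ :=
  fun x => fderiv ℝ f x (EuclideanSpace.single j (1 : ℝ))

/-- The mixed partial derivative `∂^α f = ∂_1^{α_1} ⋯ ∂_n^{α_n} f` of a function on `ℝⁿ`, for a
multi-index `α ∈ (ℕ ∪ {0})ⁿ`. -/
noncomputable def multiPartialDeriv {n : ℕ} (α : Fin n → ℕ)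
    (f : EuclideanSpace ℝ (Fin n) → ℂ) : EuclideanSpace ℝ (Fin n) → ℂ :=
  (List.finRange n).foldr (fun j g => (partialDeriv j)^[α j] g) f

/-! The theorem reduces to one-variable quasi-analyticity, with derivative bounds supplied by
moments of the Fourier transform.

Splitting an `L^p` function into an `L¹` part and an `L²` part shows that its inverse Fourier
transform is a bounded function plus an `L²` function (`exists_fourierInv_of_memLp`). Since `Δ`
becomes multiplication by `-(2π‖ξ‖)²`, comparing the transforms of `f` and `Δ^m f` gives `f = 𝓕 h`,
where the `j`-th moment of `h` is at most `D (‖f‖_p + ‖Δ^m f‖_p)` whenever `j + 2(n+1) ≤ 2m`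
(`exists_fourier_eq_and_moments_le`). One plus the `j`-th moment is a log-convex sequence `M j` that
bounds every `j`-th directional derivative of `f` along a unit vector.

On a line through `x₀` the function is flat at one point, so Bang's proof of the Denjoy–Carleman
theorem (`eq_zero_of_norm_iteratedDeriv_le`) makes it vanish, provided `∑ M j / M (j + 1)` diverges.
If that sum converged, Carleman's inequality (`summable_geom_mean`) would give convergence of `∑ M k
^ (-1/k)`. Because `M (2i)` is controlled by `‖Δ^(i+n+1) f‖_p`, and a fixed index shift is harmless
(`summable_rpow_neg_shift`), the series in the hypothesis would then converge too
(`tsum_rpow_neg_ne_top`), a contradiction. -/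

/-! ### Quasi-analyticity on the half-line -/

/-- One step of Bang's argument: bounds on the derivatives of order below `N` at `x` propagate to
`x + h`. -/
lemma norm_iteratedDeriv_add_le_exp {g : ℝ → ℂ} (hg : ContDiff ℝ ∞ g) {M : ℕ → ℝ}
    (hM : ∀ j, 0 < M j) {N : ℕ} {μ : ℝ} (hμ : 0 ≤ μ) (hstep : ∀ j < N, M (j + 1) ≤ μ * M j)
    (hN : ∀ t, ‖iteratedDeriv N g t‖ ≤ M N) {a x : ℝ} (ha : Real.exp (-N) ≤ a)
    (hx : ∀ j < N, ‖iteratedDeriv j g x‖ ≤ a * (Real.exp j * M j)) :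
    ∀ j ≤ N, ∀ h : ℝ, 0 ≤ h →
      ‖iteratedDeriv j g (x + h)‖ ≤
        a * (Real.exp j * M j) * Real.exp (Real.exp 1 * μ * h) := by
  have ha0 : 0 < a := (Real.exp_pos _).trans_le ha
  intro j hj
  induction hj using Nat.decreasingInduction with
  | self =>
    intro h hh
    refine (hN _).trans ?_
    -- At the top order the global bound suffices, because `a ≥ e^(-N)` makes the claimed bound at
    -- least `M N`.
    have h1 : M N ≤ a * (Real.exp N * M N) := by
      have : 1 ≤ a * Real.exp N := by
        calc (1 : ℝ) = Real.exp (-N) * Real.exp N := by rw [← Real.exp_add]; simp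
          _ ≤ _ := by gcongr
      calc M N = 1 * M N := (one_mul _).symm
        _ ≤ (a * Real.exp N) * M N := by gcongr; exact (hM N).le
        _ = _ := by ring
    have h2 : 1 ≤ Real.exp (Real.exp 1 * μ * h) := Real.one_le_exp (by positivity)
    exact h1.trans (le_mul_of_one_le_right ((hM N).le.trans h1) h2)
  | of_succ j hj ih =>
    intro h hh
    have hd : ∀ t, HasDerivAt (fun s => iteratedDeriv j g (x + s))
        (iteratedDeriv (j + 1) g (x + t)) t := by
      intro t
      have h1 : HasDerivAt (iteratedDeriv j g) (iteratedDeriv (j + 1) g (x + t)) (x + t) := by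
        rw [iteratedDeriv_succ]
        exact ((hg.differentiable_iteratedDeriv j (by exact_mod_cast WithTop.coe_lt_top _)) _).hasDerivAt
      exact h1.comp_const_add x t
    have hB : ∀ t, HasDerivAt
        (fun s : ℝ => a * (Real.exp j * M j) * Real.exp (Real.exp 1 * μ * s))
        (a * (Real.exp j * M j) * (Real.exp (Real.exp 1 * μ * t) * (Real.exp 1 * μ))) t := by
      intro t
      have := (((hasDerivAt_id t).const_mul (Real.exp 1 * μ)).exp).const_mul
        (a * (Real.exp j * M j))
      simpa using this
    -- Descending in `j`: the bound for order `j + 1` is at most the derivative of the bound for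
    -- order `j`. The factor `e` in the rate pays for passing from `e^j` to `e^(j+1)`, and `μ` pays
    -- for `M (j + 1) / M j`.
    refine image_norm_le_of_norm_deriv_right_le_deriv_boundary (a := 0) (b := h)
      (f := fun s => iteratedDeriv j g (x + s))
      (f' := fun t => iteratedDeriv (j + 1) g (x + t))
      (fun t _ => (hd t).continuousAt.continuousWithinAt)
      (fun t _ => (hd t).hasDerivWithinAt) ?_ hB ?_ ⟨hh, le_rfl⟩
    · simpa using hx j hj
    · intro t ht
      refine (ih t ht.1).trans ?_
      have h1 : a * (Real.exp ((j + 1 : ℕ) : ℝ) * M (j + 1)) ≤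
          a * (Real.exp j * M j) * (Real.exp 1 * μ) := by
        push_cast
        rw [Real.exp_add]
        calc a * (Real.exp j * Real.exp 1 * M (j + 1))
            ≤ a * (Real.exp j * Real.exp 1 * (μ * M j)) := by
              gcongr; exact hstep j hj
          _ = _ := by ring
      calc _ ≤ a * (Real.exp j * M j) * (Real.exp 1 * μ) * Real.exp (Real.exp 1 * μ * t) := by
            gcongr
        _ = _ := by ring

/-- The **Denjoy–Carleman theorem** for a log-convex sequence of uniform bounds. -/
theorem eq_zero_of_norm_iteratedDeriv_le {g : ℝ → ℂ} (hg : ContDiff ℝ ∞ g) {M : ℕ → ℝ}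
    (hM : ∀ j, 0 < M j) (hconv : ∀ j, M (j + 1) ^ 2 ≤ M j * M (j + 2))
    (hbound : ∀ j t, ‖iteratedDeriv j g t‖ ≤ M j)
    (hdiv : ¬ Summable fun j => M j / M (j + 1))
    (h0 : ∀ j, iteratedDeriv j g 0 = 0) {x : ℝ} (hx : 0 ≤ x) : g x = 0 := by
  set r : ℕ → ℝ := fun j => M j / M (j + 1) with hr
  have hrpos : ∀ j, 0 < r j := fun j => div_pos (hM _) (hM _)
  have hanti : Antitone r := by
    refine antitone_nat_of_succ_le fun j => ?_
    rw [hr, div_le_div_iff₀ (hM _) (hM _)]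
    nlinarith [hconv j]
  have hstep : ∀ N, ∀ j < N + 1, M (j + 1) ≤ (r N)⁻¹ * M j := by
    intro N j hj
    have h1 : r N ≤ r j := hanti (Nat.lt_succ_iff.mp hj)
    have h2 : r N * M (j + 1) ≤ M j := by
      calc r N * M (j + 1) ≤ r j * M (j + 1) := by gcongr; exact (hM _).le
        _ = M j := by rw [hr]; field_simp [(hM (j + 1)).ne']
    rw [inv_mul_eq_div, le_div_iff₀ (hrpos N)]
    linarith
  -- Induction on the number `d` of steps, for all `k` at once: the last step, from the level `k +
  -- 1` estimate to the level `k` one, has length at most `r k / e` and costs one factor `e`.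
  -- Flatness at `0` starts it for every `k`.
  have key : ∀ d k : ℕ, ∀ y : ℝ, 0 ≤ y →
      y ≤ (∑ i ∈ Finset.range d, r (i + k)) / Real.exp 1 → ∀ j ≤ k,
        ‖iteratedDeriv j g y‖ ≤ Real.exp (-k) * (Real.exp j * M j) := by
    intro d
    induction d with
    | zero =>
      intro k y hy hy' j _
      have : y = 0 := le_antisymm (by simpa using hy') hy
      rw [this, h0 j, norm_zero]
      have := (hM j).le
      positivity
    | succ d ih =>
      intro k y hy hy' j hj
      set X := (∑ i ∈ Finset.range d, r (i + (k + 1))) / Real.exp 1 with hX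
      have hX0 : 0 ≤ X := div_nonneg (Finset.sum_nonneg fun i _ => (hrpos _).le) (Real.exp_pos _).le
      have hy2 : y ≤ X + r k / Real.exp 1 := by
        rw [Finset.sum_range_succ', add_div] at hy'
        simpa [hX, add_assoc, add_comm 1 k] using hy'
      have hmin : 0 ≤ min y X := le_min hy hX0
      -- Starting from `min y X` treats `y ≤ X` (a step of length zero) and `y > X` together. The
      -- value of `a` is the smallest one allowed for `N = k + 1`.
      have := norm_iteratedDeriv_add_le_exp hg hM (N := k + 1) (inv_nonneg.mpr (hrpos k).le)
        (hstep k) (hbound (k + 1)) (a := Real.exp (-(k + 1 : ℕ))) (x := min y X) le_rfl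
        (fun j hj => ih (k + 1) _ hmin (min_le_right _ _) j hj.le) j (by omega) (y - min y X)
        (by simp)
      rw [add_sub_cancel] at this
      refine this.trans ?_
      have h1 : y - min y X ≤ r k / Real.exp 1 := by
        have := (hrpos k).le
        rcases le_total y X with h | h
        · rw [min_eq_left h, sub_self]; positivity
        · rw [min_eq_right h]; linarith
      have h2 : Real.exp 1 * (r k)⁻¹ * (y - min y X) ≤ 1 := by
        have := hrpos k
        calc Real.exp 1 * (r k)⁻¹ * (y - min y X) ≤ Real.exp 1 * (r k)⁻¹ * (r k / Real.exp 1) := by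
              gcongr
          _ = 1 := by field_simp
      have hMj := (hM j).le
      calc Real.exp (-(k + 1 : ℕ)) * (Real.exp j * M j) *
            Real.exp (Real.exp 1 * (r k)⁻¹ * (y - min y X))
          ≤ Real.exp (-(k + 1 : ℕ)) * (Real.exp j * M j) * Real.exp 1 := by gcongr
        _ = Real.exp (-(k + 1 : ℕ) + 1) * (Real.exp j * M j) := by rw [Real.exp_add]; ring
        _ = _ := by push_cast; ring_nf
  -- Every tail of `∑ r i` diverges, so for each `k` enough steps reach the fixed point `x`; then `k
  -- → ∞`.
  have hle : ∀ k : ℕ, ‖g x‖ ≤ Real.exp (-k) * M 0 := by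
    intro k
    have hk : ¬ Summable fun i => r (i + k) := fun h => hdiv ((summable_nat_add_iff k).mp h)
    have ht := (not_summable_iff_tendsto_nat_atTop_of_nonneg fun i => (hrpos (i + k)).le).mp hk
    obtain ⟨d, hd⟩ := (ht.eventually_ge_atTop (x * Real.exp 1)).exists
    simpa using key d k x hx ((le_div_iff₀ (Real.exp_pos _)).mpr hd) 0 (Nat.zero_le k)
  have hlim : Filter.Tendsto (fun k : ℕ => Real.exp (-k) * M 0) Filter.atTop (nhds (0 * M 0)) :=
    ((Real.tendsto_exp_neg_atTop_nhds_zero).comp tendsto_natCast_atTop_atTop).mul_const _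
  rw [zero_mul] at hlim
  exact norm_le_zero_iff.mp (ge_of_tendsto' hlim hle)

/-! ### Carleman's inequality and related series -/

/-- **Carleman's inequality**, qualitative form. -/
theorem summable_geom_mean {a : ℕ → ℝ} (ha : ∀ i, 0 < a i) (hs : Summable a) :
    Summable fun k : ℕ => (∏ i ∈ Finset.range (k + 1), a i) ^ (1 / ((k : ℝ) + 1)) := by
  -- Pólya-type weighting: AM–GM is applied to `(i + 1) * a i`, and `(k+1)! ≥ ((k+1)/e)^(k+1)`
  -- removes the weights. What remains is of size `A (k + 1) / ((k+1)(k+2))`, whose sum is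
  -- controlled by summation by parts.
  set A : ℕ → ℝ := fun k => ∑ i ∈ Finset.range k, ((i : ℝ) + 1) * a i with hA
  have hA0 : ∀ k, 0 ≤ A k := fun k =>
    Finset.sum_nonneg fun i _ => mul_nonneg (by positivity) (ha i).le
  have htel : ∀ n : ℕ, ∑ k ∈ Finset.range n, A (k + 1) / (((k : ℝ) + 1) * (k + 2)) =
      ∑ i ∈ Finset.range n, a i - A n / (n + 1) := by
    intro n
    induction n with
    | zero => simp [hA]
    | succ n ih =>
      rw [Finset.sum_range_succ, ih, Finset.sum_range_succ]
      have : A (n + 1) = A n + ((n : ℝ) + 1) * a n := Finset.sum_range_succ _ _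
      rw [this]
      push_cast
      field_simp
      ring
  have hsum : Summable fun k : ℕ => A (k + 1) / (((k : ℝ) + 1) * (k + 2)) := by
    refine summable_of_sum_range_le (c := ∑' i, a i)
      (fun k => div_nonneg (hA0 _) (by positivity)) fun n => ?_
    rw [htel]
    have h1 : 0 ≤ A n / ((n : ℝ) + 1) := div_nonneg (hA0 _) (by positivity)
    have h2 := hs.sum_le_tsum (Finset.range n) fun i _ => (ha i).le
    linarith
  refine Summable.of_nonneg_of_le
    (fun k => Real.rpow_nonneg (Finset.prod_nonneg fun i _ => (ha i).le) _) (fun k => ?_)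
    (hsum.mul_left (2 * Real.exp 1))
  have hk : (0 : ℝ) < (k : ℝ) + 1 := by positivity
  have hfact : ((k : ℝ) + 1) / Real.exp 1 ≤ ((k + 1).factorial : ℝ) ^ (1 / ((k : ℝ) + 1)) := by
    have h1 := Real.pow_div_factorial_le_exp (x := (k : ℝ) + 1) hk.le (k + 1)
    have h2 : (((k : ℝ) + 1) / Real.exp 1) ^ (k + 1) ≤ ((k + 1).factorial : ℝ) := by
      rw [div_pow, ← Real.exp_nat_mul]
      rw [div_le_iff₀ (by positivity)] at h1 ⊢
      push_cast
      rw [mul_one]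
      linarith
    calc ((k : ℝ) + 1) / Real.exp 1
        = ((((k : ℝ) + 1) / Real.exp 1) ^ (k + 1)) ^ (1 / ((k : ℝ) + 1)) := by
          rw [← Real.rpow_natCast, ← Real.rpow_mul (by positivity)]
          push_cast
          rw [mul_one_div_cancel hk.ne', Real.rpow_one]
      _ ≤ _ := by gcongr
  have hprod : ∏ i ∈ Finset.range (k + 1), (((i : ℝ) + 1) * a i) =
      ((k + 1).factorial : ℝ) * ∏ i ∈ Finset.range (k + 1), a i := by
    rw [Finset.prod_mul_distrib, ← Finset.prod_range_add_one_eq_factorial]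
    push_cast
    rfl
  have hamgm : (∏ i ∈ Finset.range (k + 1), (((i : ℝ) + 1) * a i)) ^ (1 / ((k : ℝ) + 1)) ≤
      A (k + 1) / (k + 1) := by
    have := Real.geom_mean_le_arith_mean (Finset.range (k + 1)) (fun _ => 1)
      (fun i => ((i : ℝ) + 1) * a i) (by simp) (by simp; positivity)
      (fun i _ => mul_nonneg (by positivity) (ha i).le)
    simpa [hA] using this
  have hP : 0 ≤ (∏ i ∈ Finset.range (k + 1), a i) ^ (1 / ((k : ℝ) + 1)) :=
    Real.rpow_nonneg (Finset.prod_nonneg fun i _ => (ha i).le) _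
  rw [hprod, Real.mul_rpow (by positivity) (Finset.prod_nonneg fun i _ => (ha i).le)] at hamgm
  have h3 : ((k : ℝ) + 1) / Real.exp 1 *
      (∏ i ∈ Finset.range (k + 1), a i) ^ (1 / ((k : ℝ) + 1)) ≤ A (k + 1) / (k + 1) :=
    (mul_le_mul_of_nonneg_right hfact hP).trans hamgm
  have h4 : (∏ i ∈ Finset.range (k + 1), a i) ^ (1 / ((k : ℝ) + 1)) ≤
      Real.exp 1 * (A (k + 1) / (((k : ℝ) + 1) * (k + 1))) := by
    have he := Real.exp_pos 1
    rw [div_mul_eq_mul_div, div_le_div_iff₀ he hk] at h3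
    rw [← mul_div_assoc, le_div_iff₀ (by positivity)]
    linarith
  refine h4.trans ?_
  rw [mul_comm 2, mul_assoc]
  gcongr
  rw [← mul_div_assoc, div_le_div_iff₀ (by positivity) (by positivity)]
  have := mul_nonneg (hA0 (k + 1)) (mul_nonneg hk.le (Nat.cast_nonneg (α := ℝ) k))
  nlinarith [this]

/-- Carleman's inequality applied to the ratios: their product telescopes to `M 0 / M (k + 1)`, and
`1 ≤ M 0` lets the numerator be dropped. -/
lemma summable_rpow_neg_of_summable_ratio {M : ℕ → ℝ} (hM : ∀ j, 0 < M j) (h0 : 1 ≤ M 0)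
    (hs : Summable fun j => M j / M (j + 1)) :
    Summable fun k : ℕ => M (k + 1) ^ (-(1 / ((k : ℝ) + 1))) := by
  refine (summable_geom_mean (fun i => div_pos (hM i) (hM (i + 1))) hs).of_nonneg_of_le
    (fun k => Real.rpow_nonneg (hM _).le _) fun k => ?_
  have hprod : ∏ i ∈ Finset.range (k + 1), M i / M (i + 1) = M 0 / M (k + 1) := by
    induction k with
    | zero => simp
    | succ k ih =>
      rw [Finset.prod_range_succ, ih]
      field_simp [(hM (k + 1)).ne', (hM (k + 1 + 1)).ne']
  rw [hprod, Real.rpow_neg (hM _).le, ← Real.inv_rpow (hM _).le]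
  have := hM (k + 1)
  gcongr
  rw [inv_eq_one_div]
  gcongr

/-- Shifting the exponents does not affect convergence of `∑ bᵢ ^ (-1 / (2 (i + 1)))`. -/
lemma summable_rpow_neg_shift {b : ℕ → ℝ} (hb : ∀ i, 1 ≤ b i) {C : ℝ} (hC : 1 ≤ C) (q : ℕ)
    (hs : Summable fun i : ℕ => (C * b i) ^ (-(1 / (2 * ((i : ℝ) + 1))))) :
    Summable fun i : ℕ => b i ^ (-(1 / (2 * ((i : ℝ) + q + 1)))) := by
  set t : ℕ → ℝ := fun i => b i ^ (-(1 / (2 * ((i : ℝ) + 1)))) with ht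
  have hb0 : ∀ i, 0 < b i := fun i => one_pos.trans_le (hb i)
  have hts : Summable t := by
    refine (hs.mul_left C).of_nonneg_of_le (fun i => Real.rpow_nonneg (hb0 i).le _) fun i => ?_
    rw [Real.mul_rpow (by positivity) (hb0 i).le, ← mul_assoc]
    refine le_mul_of_one_le_left (Real.rpow_nonneg (hb0 i).le _) ?_
    calc (1 : ℝ) = C * C ^ (-1 : ℝ) := by
          rw [Real.rpow_neg_one, mul_inv_cancel₀ (by positivity)]
      _ ≤ C * C ^ (-(1 / (2 * ((i : ℝ) + 1)))) := by
          gcongr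
          rw [div_le_one (by positivity)]
          have : (0 : ℝ) ≤ i := Nat.cast_nonneg i
          linarith
  have hsq : Summable fun i : ℕ => 1 / ((i : ℝ) + 1) ^ 2 := by
    have := (summable_nat_add_iff 1).mpr (Real.summable_one_div_nat_pow.mpr one_lt_two)
    simpa using this
  refine ((hts.add hsq).mul_left (Real.exp (2 * q))).of_nonneg_of_le
    (fun i => Real.rpow_nonneg (hb0 i).le _) fun i => ?_
  have hi : (0 : ℝ) < (i : ℝ) + 1 := by positivity
  have hiq : (0 : ℝ) < (i : ℝ) + q + 1 := by positivity
  set θ : ℝ := q / ((i : ℝ) + q + 1) with hθ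
  have hθ0 : 0 ≤ θ := by positivity
  have hθ1 : 0 ≤ 1 - θ := by
    rw [sub_nonneg, hθ, div_le_one hiq]; linarith
  have ht0 : 0 < t i := Real.rpow_pos_of_pos (hb0 i) _
  have hpow : b i ^ (-(1 / (2 * ((i : ℝ) + q + 1)))) = t i ^ (1 - θ) := by
    rw [ht, ← Real.rpow_mul (hb0 i).le]
    congr 1
    rw [hθ]
    field_simp
    ring
  -- The shifted term is `t i ^ (1 - θ)`, and `t i ^ (-θ)` may be large when `t i` is tiny. Adding a
  -- summable term bounds `s` below by `(i + 1)^(-2)`, so that `s ^ (-θ)` stays below `e^(2q)`.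
  set s : ℝ := t i + 1 / ((i : ℝ) + 1) ^ 2 with hsdef
  have hs0 : 0 < s := by positivity
  have hinv : s ^ (-θ) ≤ Real.exp (2 * q) := by
    have h1 : s ^ (-θ) ≤ (1 / ((i : ℝ) + 1) ^ 2) ^ (-θ) :=
      Real.rpow_le_rpow_of_nonpos (by positivity) (by linarith) (by linarith)
    refine h1.trans ?_
    have h2 : (1 / ((i : ℝ) + 1) ^ 2) ^ (-θ) = Real.exp (2 * (θ * Real.log ((i : ℝ) + 1))) := by
      rw [Real.rpow_def_of_pos (by positivity), one_div, Real.log_inv, Real.log_pow]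
      congr 1
      push_cast
      ring
    rw [h2]
    gcongr
    have h3 : Real.log ((i : ℝ) + 1) ≤ (i : ℝ) + q + 1 := by
      have := Real.log_le_sub_one_of_pos hi
      have hq : (0 : ℝ) ≤ q := Nat.cast_nonneg q
      linarith
    calc θ * Real.log ((i : ℝ) + 1) ≤ θ * ((i : ℝ) + q + 1) := by gcongr
      _ = q := by rw [hθ]; field_simp
  calc b i ^ (-(1 / (2 * ((i : ℝ) + q + 1)))) = t i ^ (1 - θ) := hpow
    _ ≤ s ^ (1 - θ) := by
        refine Real.rpow_le_rpow ht0.le ?_ hθ1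
        have : 0 < 1 / ((i : ℝ) + 1) ^ 2 := by positivity
        linarith
    _ = s ^ (-θ) * s := by
        rw [sub_eq_neg_add, Real.rpow_add hs0, Real.rpow_one]
    _ ≤ Real.exp (2 * q) * s := by gcongr

/-- If `M` has summable ratios and is controlled at even indices by a shift of `a`, then the
Carleman-type series of `a` converges. -/
lemma tsum_rpow_neg_ne_top {a : ℕ → ℝ≥0∞} (ha : ∀ i, a i ≠ 0) (ha' : ∀ i, a i ≠ ⊤)
    {M : ℕ → ℝ} (hM : ∀ j, 0 < M j) (h0 : 1 ≤ M 0) {C : ℝ} (hC : 1 ≤ C) (q : ℕ)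
    (hMa : ∀ i, M (2 * (i + 1)) ≤ C * max 1 (a (i + q)).toReal)
    (hs : Summable fun j => M j / M (j + 1)) :
    ∑' i : ℕ, a i ^ (-(1 / (2 * ((i : ℝ) + 1)))) ≠ ⊤ := by
  have h1 := summable_rpow_neg_of_summable_ratio hM h0 hs
  have hinj : Function.Injective fun i : ℕ => 2 * i + 1 := fun i j h => by
    simpa using h
  have h2 : Summable fun i : ℕ => (C * max 1 (a (i + q)).toReal) ^ (-(1 / (2 * ((i : ℝ) + 1)))) := by
    refine (h1.comp_injective hinj).of_nonneg_of_le (fun i => by positivity) fun i => ?_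
    have he : (((2 * i + 1 : ℕ) : ℝ) + 1) = 2 * ((i : ℝ) + 1) := by push_cast; ring
    simp only [Function.comp_apply, he]
    exact Real.rpow_le_rpow_of_nonpos (hM _) (hMa i) (by
      rw [neg_nonpos]; positivity)
  have h3 := summable_rpow_neg_shift (b := fun i => max 1 (a (i + q)).toReal)
    (fun i => le_max_left _ _) hC q h2
  -- Terms of a convergent series are eventually below `1`, whereas a power of `1` equals `1`. Hence
  -- the maximum with `1` is eventually attained by `a` itself and can be removed.
  have hlt := h3.tendsto_atTop_zero.eventually_lt_const one_pos
  obtain ⟨N, hN⟩ := Filter.eventually_atTop.mp hlt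
  set F : ℕ → ℝ≥0∞ := fun i => a i ^ (-(1 / (2 * ((i : ℝ) + 1)))) with hF
  have hsplit : ∑' i, F i = ∑ i ∈ Finset.range (N + q), F i + ∑' i, F (i + (N + q)) :=
    (ENNReal.summable.sum_add_tsum_nat_add' (k := N + q)).symm
  rw [hsplit]
  refine ENNReal.add_ne_top.mpr ⟨?_, ?_⟩
  · refine (ENNReal.sum_lt_top.mpr fun i _ => ?_).ne
    exact (ENNReal.rpow_ne_top_of_ne_zero (ha i) (ha' i)).lt_top
  · have h4 := (summable_nat_add_iff N).mpr h3
    refine ne_top_of_le_ne_top h4.tsum_ofReal_ne_top (ENNReal.tsum_le_tsum fun i => ?_)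
    have h5 := hN (i + N) (by omega)
    have h6 : max 1 (a (i + N + q)).toReal = (a (i + N + q)).toReal := by
      refine max_eq_right (le_of_not_gt fun h => ?_)
      simp only [max_eq_left h.le, Real.one_rpow, lt_self_iff_false] at h5
    have hpos : 0 < (a (i + N + q)).toReal := ENNReal.toReal_pos (ha _) (ha' _)
    have h7 : i + (N + q) = i + N + q := by ring
    rw [h6, ← ENNReal.ofReal_rpow_of_pos hpos, ENNReal.ofReal_toReal (ha' _), hF, h7]
    push_cast
    exact le_rfl

/-! ### Mixed partial derivatives -/

section PartialDerivatives

variable {n : ℕ}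

lemma ContDiff.partialDeriv {u : EuclideanSpace ℝ (Fin n) → ℂ} (hu : ContDiff ℝ ∞ u) (i : Fin n) :
    ContDiff ℝ ∞ (partialDeriv i u) :=
  (hu.fderiv_right (m := ∞) (by simp)).clm_apply contDiff_const

lemma ContDiff.iterate_partialDeriv {u : EuclideanSpace ℝ (Fin n) → ℂ} (hu : ContDiff ℝ ∞ u)
    (i : Fin n) (k : ℕ) : ContDiff ℝ ∞ ((_root_.partialDeriv i)^[k] u) := by
  induction k with
  | zero => exact hu
  | succ k ih => rw [Function.iterate_succ_apply']; exact ih.partialDeriv i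

lemma partialDeriv_comm {u : EuclideanSpace ℝ (Fin n) → ℂ} (hu : ContDiff ℝ ∞ u) (i j : Fin n) :
    partialDeriv i (partialDeriv j u) = partialDeriv j (partialDeriv i u) := by
  have hd : ∀ x, DifferentiableAt ℝ (fderiv ℝ u) x := fun x =>
    (hu.fderiv_right (m := ∞) (by simp)).differentiable (by simp) x
  have key : ∀ i j x, partialDeriv i (partialDeriv j u) x =
      fderiv ℝ (fderiv ℝ u) x (EuclideanSpace.single i 1) (EuclideanSpace.single j 1) := by
    intro i j x
    unfold partialDeriv
    rw [fderiv_clm_apply (hd x) (differentiableAt_const _)]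
    simp
  ext x
  rw [key, key]
  exact ((contDiff_infty.mp hu 2).contDiffAt.isSymmSndFDerivAt (by simp)) _ _

lemma partialDeriv_iterate_comm {u : EuclideanSpace ℝ (Fin n) → ℂ} (hu : ContDiff ℝ ∞ u)
    (i j : Fin n) (k : ℕ) :
    (partialDeriv j)^[k] (partialDeriv i u) = partialDeriv i ((partialDeriv j)^[k] u) := by
  induction k with
  | zero => rfl
  | succ k ih =>
    rw [Function.iterate_succ_apply', ih, partialDeriv_comm (hu.iterate_partialDeriv j k),
      Function.iterate_succ_apply']

lemma contDiff_foldr_partialDeriv {u : EuclideanSpace ℝ (Fin n) → ℂ} (hu : ContDiff ℝ ∞ u)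
    (α : Fin n → ℕ) (l : List (Fin n)) :
    ContDiff ℝ ∞ (l.foldr (fun j g => (partialDeriv j)^[α j] g) u) := by
  induction l with
  | nil => exact hu
  | cons j l ih => exact ih.iterate_partialDeriv j _

lemma foldr_partialDeriv_comm {u : EuclideanSpace ℝ (Fin n) → ℂ} (hu : ContDiff ℝ ∞ u)
    (i : Fin n) (α : Fin n → ℕ) (l : List (Fin n)) :
    l.foldr (fun j g => (partialDeriv j)^[α j] g) (partialDeriv i u) =
      partialDeriv i (l.foldr (fun j g => (partialDeriv j)^[α j] g) u) := by
  induction l with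
  | nil => rfl
  | cons j l ih =>
    rw [List.foldr_cons, ih, partialDeriv_iterate_comm (contDiff_foldr_partialDeriv hu α l),
      List.foldr_cons]

lemma foldr_partialDeriv_update_of_notMem {u : EuclideanSpace ℝ (Fin n) → ℂ}
    (i : Fin n) (α : Fin n → ℕ) (k : ℕ) (l : List (Fin n)) (hi : i ∉ l) :
    l.foldr (fun j g => (partialDeriv j)^[Function.update α i k j] g) u =
      l.foldr (fun j g => (partialDeriv j)^[α j] g) u := by
  induction l with
  | nil => rfl
  | cons j l ih =>
    rw [List.mem_cons, not_or] at hi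
    rw [List.foldr_cons, ih hi.2, List.foldr_cons, Function.update_of_ne (Ne.symm hi.1)]

/-- The fold differentiates in a fixed order, so the innermost derivative must be commuted outwards
to the place of `i`; absence of duplicates ensures that `i` is met only once. -/
lemma foldr_partialDeriv_of_mem {u : EuclideanSpace ℝ (Fin n) → ℂ} (hu : ContDiff ℝ ∞ u)
    (i : Fin n) (α : Fin n → ℕ) (l : List (Fin n)) (hl : l.Nodup) (hi : i ∈ l) :
    l.foldr (fun j g => (partialDeriv j)^[α j] g) (partialDeriv i u) =
      l.foldr (fun j g => (partialDeriv j)^[Function.update α i (α i + 1) j] g) u := by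
  induction l with
  | nil => simp at hi
  | cons j l ih =>
    rw [List.nodup_cons] at hl
    rw [List.foldr_cons, List.foldr_cons]
    by_cases hij : i = j
    · subst hij
      rw [foldr_partialDeriv_update_of_notMem i α _ l hl.1, Function.update_self,
        foldr_partialDeriv_comm hu, ← Function.iterate_succ_apply]
    · have hil : i ∈ l := (List.mem_cons.mp hi).resolve_left hij
      rw [ih hl.2 hil, Function.update_of_ne (Ne.symm hij)]

lemma multiPartialDeriv_partialDeriv {u : EuclideanSpace ℝ (Fin n) → ℂ} (hu : ContDiff ℝ ∞ u)
    (i : Fin n) (α : Fin n → ℕ) :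
    multiPartialDeriv α (partialDeriv i u) =
      multiPartialDeriv (Function.update α i (α i + 1)) u :=
  foldr_partialDeriv_of_mem hu i α _ (List.nodup_finRange n) (List.mem_finRange i)

lemma multiPartialDeriv_zero (u : EuclideanSpace ℝ (Fin n) → ℂ) : multiPartialDeriv 0 u = u := by
  have : ∀ l : List (Fin n),
      l.foldr (fun j g => (partialDeriv j)^[(0 : Fin n → ℕ) j] g) u = u := by
    intro l
    induction l with
    | nil => rfl
    | cons j l ih => rw [List.foldr_cons, ih]; rfl
  exact this _

/-- If all mixed partial derivatives vanish at a point, so do all Fréchet derivatives. -/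
theorem iteratedFDeriv_eq_zero_of_multiPartialDeriv {u : EuclideanSpace ℝ (Fin n) → ℂ}
    (hu : ContDiff ℝ ∞ u) {x₀ : EuclideanSpace ℝ (Fin n)}
    (h : ∀ α : Fin n → ℕ, multiPartialDeriv α u x₀ = 0) (k : ℕ) :
    iteratedFDeriv ℝ k u x₀ = 0 := by
  have key : ∀ (k : ℕ) (u : EuclideanSpace ℝ (Fin n) → ℂ), ContDiff ℝ ∞ u →
      (∀ α : Fin n → ℕ, multiPartialDeriv α u x₀ = 0) → ∀ σ : Fin k → Fin n,
      iteratedFDeriv ℝ k u x₀ (fun i => EuclideanSpace.single (σ i) 1) = 0 := by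
    intro k
    induction k with
    | zero =>
      intro u _ h σ
      rw [iteratedFDeriv_zero_apply, ← multiPartialDeriv_zero u]
      exact h 0
    | succ k ih =>
      intro u hu h σ
      -- The last direction is peeled off to match `iteratedFDeriv_succ_apply_right`, which
      -- differentiates `fderiv ℝ u`. All mixed partials of `∂_i u` are again mixed partials of `u`,
      -- so the induction ranges over `u`.
      have h1 := ih (partialDeriv (σ (Fin.last k)) u) (hu.partialDeriv _)
        (fun α => by rw [multiPartialDeriv_partialDeriv hu]; exact h _) (fun i => σ i.castSucc)
      have h2 : partialDeriv (σ (Fin.last k)) u =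
          (ContinuousLinearMap.apply ℝ ℂ (EuclideanSpace.single (σ (Fin.last k)) (1 : ℝ))) ∘
            fderiv ℝ u := rfl
      rw [h2, ContinuousLinearMap.iteratedFDeriv_comp_left _
        (hu.fderiv_right (m := ∞) (by simp)).contDiffAt (i := k) (by exact_mod_cast le_top)] at h1
      rw [iteratedFDeriv_succ_apply_right]
      exact h1
  refine ContinuousMultilinearMap.toMultilinearMap_injective ?_
  refine Module.Basis.ext_multilinear (fun _ => (EuclideanSpace.basisFun (Fin n) ℝ).toBasis) ?_
  intro σ
  simpa using key k u hu h σ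

end PartialDerivatives

/-! ### Integration by parts for the Laplacian -/

section WeakLaplacian

open Laplacian SchwartzMap

variable {n : ℕ}

local notation "E" => EuclideanSpace ℝ (Fin n)

lemma laplacian_eq_sum_fderiv {u : E → ℂ} (hu : ContDiff ℝ ∞ u) (x : E) :
    laplacian u x = ∑ i, partialDeriv i (partialDeriv i u) x := by
  rw [InnerProductSpace.laplacian_eq_iteratedFDeriv_orthonormalBasis u
    (EuclideanSpace.basisFun (Fin n) ℝ)]
  refine Finset.sum_congr rfl fun i _ => ?_
  have hd : DifferentiableAt ℝ (fderiv ℝ u) x :=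
    (hu.fderiv_right (m := ∞) (by simp)).differentiable (by simp) x
  unfold partialDeriv
  rw [iteratedFDeriv_two_apply, fderiv_clm_apply hd (differentiableAt_const _)]
  simp

lemma ContDiff.laplacian_euclidean {u : E → ℂ} (hu : ContDiff ℝ ∞ u) :
    ContDiff ℝ ∞ (laplacian u) := by
  have : laplacian u = fun x => ∑ i, _root_.partialDeriv i (_root_.partialDeriv i u) x :=
    funext (laplacian_eq_sum_fderiv hu)
  rw [this]
  exact ContDiff.sum fun i _ => (hu.partialDeriv i).partialDeriv i

lemma HasCompactSupport.partialDeriv {w : E → ℂ} (hw : HasCompactSupport w) (i : Fin n) :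
    HasCompactSupport (_root_.partialDeriv i w) :=
  hw.fderiv_apply (𝕜 := ℝ) _

lemma integral_partialDeriv_mul {u w : E → ℂ} (hu : ContDiff ℝ ∞ u) (hw : ContDiff ℝ ∞ w)
    (hs : HasCompactSupport w) (i : Fin n) :
    ∫ x, partialDeriv i u x * w x = -∫ x, u x * partialDeriv i w x := by
  have h := integral_mul_fderiv_eq_neg_fderiv_mul_of_integrable (μ := volume) (f := u) (g := w)
    (v := EuclideanSpace.single i (1 : ℝ))
    (((hu.partialDeriv i).continuous.mul hw.continuous).integrable_of_hasCompactSupport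
      hs.mul_left)
    ((hu.continuous.mul (hw.partialDeriv i).continuous).integrable_of_hasCompactSupport
      (hs.partialDeriv i).mul_left)
    ((hu.continuous.mul hw.continuous).integrable_of_hasCompactSupport hs.mul_left)
    (fun x _ => hu.differentiable (by simp) x) (fun x _ => hw.differentiable (by simp) x)
  exact (neg_eq_iff_eq_neg.mpr h).symm

lemma integral_laplacian_mul_of_hasCompactSupport {u w : E → ℂ} (hu : ContDiff ℝ ∞ u)
    (hw : ContDiff ℝ ∞ w) (hs : HasCompactSupport w) :
    ∫ x, laplacian u x * w x = ∫ x, u x * laplacian w x := by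
  simp only [laplacian_eq_sum_fderiv hu, laplacian_eq_sum_fderiv hw, Finset.sum_mul,
    Finset.mul_sum]
  rw [integral_finsetSum, integral_finsetSum]
  · refine Finset.sum_congr rfl fun i _ => ?_
    rw [integral_partialDeriv_mul (hu.partialDeriv i) hw hs,
      integral_partialDeriv_mul hu (hw.partialDeriv i) (hs.partialDeriv i), neg_neg]
  · exact fun i _ => (hu.continuous.mul
      ((hw.partialDeriv i).partialDeriv i).continuous).integrable_of_hasCompactSupport
      ((hs.partialDeriv i).partialDeriv i).mul_left
  · exact fun i _ => (((hu.partialDeriv i).partialDeriv i).continuous.mul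
      hw.continuous).integrable_of_hasCompactSupport hs.mul_left

lemma norm_laplacian_le (w : E → ℂ) (x : E) :
    ‖laplacian w x‖ ≤ n * ‖iteratedFDeriv ℝ 2 w x‖ := by
  rw [InnerProductSpace.laplacian_eq_iteratedFDeriv_orthonormalBasis w
    (EuclideanSpace.basisFun (Fin n) ℝ)]
  refine (norm_sum_le _ _).trans ?_
  calc _ ≤ ∑ _i : Fin n, ‖iteratedFDeriv ℝ 2 w x‖ := Finset.sum_le_sum fun i _ => by
        refine (ContinuousMultilinearMap.le_opNorm _ _).trans ?_
        simp [Fin.prod_univ_two]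
    _ = _ := by simp

/-- Smooth cutoff functions exhausting the space, with uniformly bounded derivatives of order at
most two. -/
lemma exists_cutoff (n : ℕ) : ∃ (χ : ℕ → EuclideanSpace ℝ (Fin n) → ℂ) (K : ℝ),
    (∀ N, ContDiff ℝ ∞ (χ N)) ∧ (∀ N, HasCompactSupport (χ N)) ∧
    (∀ N, ∀ j ≤ 2, ∀ x, ‖iteratedFDeriv ℝ j (χ N) x‖ ≤ K) ∧
    (∀ x, ∀ᶠ N in Filter.atTop, χ N =ᶠ[nhds x] fun _ => 1) := by
  let b : ContDiffBump (0 : EuclideanSpace ℝ (Fin n)) := ⟨1, 2, one_pos, one_lt_two⟩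
  let χ₀ : EuclideanSpace ℝ (Fin n) → ℂ := fun x => (b x : ℂ)
  have hsm : ContDiff ℝ ∞ χ₀ := Complex.ofRealCLM.contDiff.comp b.contDiff
  have hcs : HasCompactSupport χ₀ := b.hasCompactSupport.comp_left (g := Complex.ofReal) (by simp)
  let L : ℕ → EuclideanSpace ℝ (Fin n) →L[ℝ] EuclideanSpace ℝ (Fin n) := fun N =>
    ((N : ℝ) + 1)⁻¹ • ContinuousLinearMap.id ℝ _
  have hL : ∀ N, ‖L N‖ ≤ 1 := fun N => by
    refine ContinuousLinearMap.opNorm_le_bound _ zero_le_one fun x => ?_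
    have h1 : ((N : ℝ) + 1)⁻¹ ≤ 1 := inv_le_one_of_one_le₀ (by simp)
    have h0 : (0 : ℝ) ≤ ((N : ℝ) + 1)⁻¹ := by positivity
    simp only [L, smul_apply, ContinuousLinearMap.id_apply, norm_smul,
      Real.norm_of_nonneg h0]
    gcongr
  have hbd : ∀ j, ∃ K : ℝ, ∀ x, ‖iteratedFDeriv ℝ j χ₀ x‖ ≤ K := fun j =>
    (hcs.iteratedFDeriv (𝕜 := ℝ) j).exists_bound_of_continuous
      (hsm.continuous_iteratedFDeriv (m := j) (by exact_mod_cast le_top))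
  choose K hK using hbd
  have hK0 : ∀ j, 0 ≤ K j := fun j => (norm_nonneg _).trans (hK j 0)
  refine ⟨fun N => χ₀ ∘ L N, K 0 + K 1 + K 2, fun N => hsm.comp (L N).contDiff, fun N => ?_,
    fun N j hj x => ?_, fun x => ?_⟩
  · have hN : ((N : ℝ) + 1)⁻¹ ≠ 0 := by positivity
    exact hcs.comp_homeomorph (Homeomorph.smulOfNeZero _ hN)
  · rw [ContinuousLinearMap.iteratedFDeriv_comp_right (L N) hsm x (by exact_mod_cast le_top)]
    refine (ContinuousMultilinearMap.norm_compContinuousLinearMap_le _ _).trans ?_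
    have h1 : ∏ _i : Fin j, ‖L N‖ ≤ 1 := Finset.prod_le_one (fun _ _ => norm_nonneg _) fun _ _ => hL N
    refine (mul_le_of_le_one_right (norm_nonneg _) h1).trans ((hK j _).trans ?_)
    have := hK0 0
    have := hK0 1
    have := hK0 2
    interval_cases j <;> linarith
  · obtain ⟨N₀, hN₀⟩ := exists_nat_gt ‖x‖
    refine Filter.eventually_atTop.mpr ⟨N₀, fun N hN => ?_⟩
    have hx : ‖x‖ < (N : ℝ) + 1 := by
      have : (N₀ : ℝ) ≤ N := by exact_mod_cast hN
      linarith
    filter_upwards [(isOpen_lt continuous_norm continuous_const).mem_nhds hx] with y hy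
    have : b (L N y) = 1 := by
      refine b.one_of_mem_closedBall ?_
      rw [mem_closedBall_zero_iff]
      have h0 : (0 : ℝ) < (N : ℝ) + 1 := by positivity
      simp only [L, smul_apply, ContinuousLinearMap.id_apply, norm_smul,
        Real.norm_of_nonneg (inv_pos.mpr h0).le]
      rw [inv_mul_le_iff₀ h0, mul_one]
      exact le_of_lt hy
    simp [χ₀, this]

/-- Hölder's inequality, as Schwartz functions lie in `L^q` for the conjugate exponent `q`. It
provides the dominating functions when cutoffs are removed. -/
lemma integrable_mul_schwartz {F : Type*} [NormedAddCommGroup F] [NormedSpace ℝ F] {u : E → ℂ}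
    {p : ℝ≥0∞} (hp : 1 ≤ p) (hu : MemLp u p volume) (ψ : 𝓢(E, F)) :
    Integrable (fun x => ‖u x‖ * ‖ψ x‖) volume := by
  have : p.HolderConjugate p.conjExponent := ENNReal.HolderConjugate.conjExponent hp
  exact hu.norm.integrable_mul (ψ.memLp p.conjExponent volume).norm

/-- The Laplacian of a smooth function in `L^p` is the distributional Laplacian when tested against
Schwartz functions. -/
theorem integral_laplacian_mul_schwartz {u : E → ℂ} (hu : ContDiff ℝ ∞ u) {p : ℝ≥0∞} (hp : 1 ≤ p)
    (hup : MemLp u p volume) (hLup : MemLp (laplacian u) p volume) (ψ : 𝓢(E, ℂ)) :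
    ∫ x, laplacian u x * ψ x = ∫ x, u x * laplacian ψ x := by
  obtain ⟨χ, K, hsm, hcs, hK, hone⟩ := exists_cutoff n
  have hw : ∀ N, ContDiff ℝ ∞ (fun x => χ N x * ψ x) := fun N => (hsm N).mul (ψ.smooth ⊤)
  have hws : ∀ N, HasCompactSupport (fun x => χ N x * ψ x) := fun N => (hcs N).mul_right
  have hχ : ∀ N x, ‖χ N x‖ ≤ K := fun N x => by simpa using hK N 0 (by simp) x
  have hK0 : 0 ≤ K := (norm_nonneg _).trans (hχ 0 0)
  have h1 : Filter.Tendsto (fun N => ∫ x, laplacian u x * (χ N x * ψ x)) Filter.atTop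
      (nhds (∫ x, laplacian u x * ψ x)) := by
    refine tendsto_integral_of_dominated_convergence (fun x => K * (‖laplacian u x‖ * ‖ψ x‖))
      (fun N => (hu.laplacian_euclidean.continuous.mul (hw N).continuous).aestronglyMeasurable)
      ((integrable_mul_schwartz hp hLup ψ).const_mul K) (fun N => ?_) ?_
    · refine Filter.Eventually.of_forall fun x => ?_
      rw [norm_mul, norm_mul]
      calc _ = ‖χ N x‖ * (‖laplacian u x‖ * ‖ψ x‖) := by ring
        _ ≤ _ := by gcongr; exact hχ N x
    · refine Filter.Eventually.of_forall fun x => tendsto_const_nhds.congr' ?_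
      filter_upwards [hone x] with N hN
      rw [hN.eq_of_nhds, one_mul]
  -- The Leibniz rule bounds the Laplacian of `χ N * ψ` uniformly in `N` by `ψ` and its first two
  -- derivatives, and near each point the cutoff is eventually constant `1`.
  have h2 : Filter.Tendsto (fun N => ∫ x, u x * laplacian (fun y => χ N y * ψ y) x) Filter.atTop
      (nhds (∫ x, u x * laplacian ψ x)) := by
    let ψ₁ := fderivCLM ℝ E ℂ ψ
    let ψ₂ := fderivCLM ℝ E (E →L[ℝ] ℂ) ψ₁
    refine tendsto_integral_of_dominated_convergence
      (fun x => n * K * (‖u x‖ * ‖ψ₂ x‖ + 2 * (‖u x‖ * ‖ψ₁ x‖) + ‖u x‖ * ‖ψ x‖))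
      (fun N => (hu.continuous.mul (hw N).laplacian_euclidean.continuous).aestronglyMeasurable)
      ((((integrable_mul_schwartz hp hup ψ₂).add
        ((integrable_mul_schwartz hp hup ψ₁).const_mul 2)).add
        (integrable_mul_schwartz hp hup ψ)).const_mul _) (fun N => ?_) ?_
    · refine Filter.Eventually.of_forall fun x => ?_
      have e0 : ‖iteratedFDeriv ℝ (2 - 2) ψ x‖ = ‖ψ x‖ := norm_iteratedFDeriv_zero
      have e1 : ‖iteratedFDeriv ℝ 1 ψ x‖ = ‖ψ₁ x‖ := norm_iteratedFDeriv_one ψ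
      have e2 : ‖iteratedFDeriv ℝ 2 ψ x‖ = ‖ψ₂ x‖ := by
        rw [← norm_iteratedFDeriv_fderiv]
        exact norm_iteratedFDeriv_one _
      have h3 := norm_iteratedFDeriv_mul_le (𝕜 := ℝ) (contDiff_infty.mp (hsm N) 2) (ψ.smooth 2) x
        (n := 2) le_rfl
      have h4 : ‖iteratedFDeriv ℝ 2 (fun y => χ N y * ψ y) x‖ ≤
          K * (‖ψ₂ x‖ + 2 * ‖ψ₁ x‖ + ‖ψ x‖) := by
        refine h3.trans ?_
        have g0 := hK N 0 (by norm_num) x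
        have g1 := hK N 1 (by norm_num) x
        have g2 := hK N 2 (by norm_num) x
        rw [Finset.sum_range_succ, Finset.sum_range_succ, Finset.sum_range_one]
        simp only [Nat.choose_zero_right, Nat.choose_one_right, Nat.choose_self, Nat.sub_zero,
          Nat.cast_one, one_mul, Nat.cast_ofNat, e0, e1, e2, norm_iteratedFDeriv_zero] at g0 ⊢
        nlinarith [mul_le_mul_of_nonneg_right g0 (norm_nonneg (ψ₂ x)),
          mul_le_mul_of_nonneg_right g1 (norm_nonneg (ψ₁ x)),
          mul_le_mul_of_nonneg_right g2 (norm_nonneg (ψ x))]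
      rw [norm_mul]
      calc ‖u x‖ * ‖laplacian (fun y => χ N y * ψ y) x‖
          ≤ ‖u x‖ * (n * (K * (‖ψ₂ x‖ + 2 * ‖ψ₁ x‖ + ‖ψ x‖))) := by
            gcongr
            exact (norm_laplacian_le _ x).trans (by gcongr)
        _ = _ := by ring
    · refine Filter.Eventually.of_forall fun x => tendsto_const_nhds.congr' ?_
      filter_upwards [hone x] with N hN
      congr 1
      rw [SchwartzMap.laplacian_apply]
      refine (InnerProductSpace.laplacian_congr_nhds ?_).eq_of_nhds
      filter_upwards [hN] with y hy
      rw [hy, one_mul]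
  refine tendsto_nhds_unique h1 (h2.congr fun N => ?_)
  exact (integral_laplacian_mul_of_hasCompactSupport hu (hw N) (hws N)).symm

end WeakLaplacian

/-! ### The inverse Fourier transform on `L^p`, `1 ≤ p ≤ 2` -/

/-- A function in `L^p` with `1 ≤ p ≤ 2` is the sum of a function in `L¹` and one in `L²`, with
norms bounded by that of the given function. -/
lemma exists_add_eq_of_memLp {α : Type*} [MeasurableSpace α] {μ : Measure α} {u : α → ℂ}
    (hu : StronglyMeasurable u) {p : ℝ≥0∞} (hp1 : 1 ≤ p) (hp2 : p ≤ 2) (hup : MemLp u p μ) :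
    ∃ u₁ u₂ : α → ℂ, (∀ x, u x = u₁ x + u₂ x) ∧ AEStronglyMeasurable u₁ μ ∧
      AEStronglyMeasurable u₂ μ ∧ eLpNorm u₁ 1 μ ≤ eLpNorm u p μ ∧
      eLpNorm u₂ 2 μ ≤ eLpNorm u p μ := by
  set A := eLpNorm u p μ with hA
  have hp0 : p ≠ 0 := (one_pos.trans_le hp1).ne'
  have hpt : p ≠ ⊤ := (hp2.trans_lt (by norm_num)).ne
  have hAt : A ≠ ⊤ := hup.2.ne
  -- The main case cancels a power of `A`, so `A = 0` is separated.
  by_cases hA0 : A = 0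
  · have hz : u =ᵐ[μ] 0 := (eLpNorm_eq_zero_iff hu.aestronglyMeasurable hp0).mp hA0
    refine ⟨u, 0, by simp, hu.aestronglyMeasurable, aestronglyMeasurable_zero, ?_, by simp⟩
    rw [eLpNorm_congr_ae hz]; simp
  set r := p.toReal with hr
  have hr1 : 1 ≤ r := by
    rw [hr, ← ENNReal.toReal_one]; exact ENNReal.toReal_mono hpt hp1
  have hr2 : r ≤ 2 := by
    rw [hr, ← ENNReal.toReal_ofNat]; exact ENNReal.toReal_mono (by norm_num) hp2
  have hAp : ∫⁻ x, ‖u x‖ₑ ^ r ∂μ = A ^ r := by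
    rw [hA, eLpNorm_eq_lintegral_rpow_enorm_toReal hp0 hpt, ← hr, ← ENNReal.rpow_mul,
      one_div_mul_cancel (by positivity), ENNReal.rpow_one]
  -- Cutting at the height of the norm itself gives both bounds with constant one: `A^(r-1)|u| ≤
  -- |u|^r` on `S`, and `|u|² ≤ A^(2-r)|u|^r` off `S`.
  set S : Set α := {x | A < ‖u x‖ₑ} with hS
  have hSm : MeasurableSet S := measurableSet_lt measurable_const hu.enorm
  refine ⟨S.indicator u, Sᶜ.indicator u, fun x => ?_,
    (hu.indicator hSm).aestronglyMeasurable, (hu.indicator hSm.compl).aestronglyMeasurable, ?_, ?_⟩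
  · exact (congrFun (Set.indicator_self_add_compl S u) x).symm
  · rw [eLpNorm_one_eq_lintegral_enorm]
    have h1 : A ^ (r - 1) * ∫⁻ x, ‖S.indicator u x‖ₑ ∂μ ≤ A ^ (r - 1) * A := by
      rw [← lintegral_const_mul _ (hu.indicator hSm).enorm]
      calc _ ≤ ∫⁻ x, ‖u x‖ₑ ^ r ∂μ := by
            refine lintegral_mono fun x => ?_
            by_cases hx : x ∈ S
            · rw [Set.indicator_of_mem hx]
              calc A ^ (r - 1) * ‖u x‖ₑ ≤ ‖u x‖ₑ ^ (r - 1) * ‖u x‖ₑ := by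
                    gcongr
                    exact le_of_lt hx
                _ = ‖u x‖ₑ ^ r := by
                    conv_lhs => rw [← ENNReal.rpow_one ‖u x‖ₑ, ← ENNReal.rpow_mul, one_mul]
                    rw [← ENNReal.rpow_add_of_nonneg _ _ (by linarith) zero_le_one]
                    simp
            · simp [Set.indicator_of_notMem hx]
        _ = A ^ r := hAp
        _ = A ^ (r - 1) * A := by
            conv_rhs => rw [← ENNReal.rpow_one A, ← ENNReal.rpow_mul, one_mul]
            rw [← ENNReal.rpow_add_of_nonneg _ _ (by linarith) zero_le_one]
            simp
    exact (ENNReal.mul_le_mul_iff_right (by simp [hA0, hAt]) (by simp [hA0, hAt])).mp h1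
  · rw [eLpNorm_eq_lintegral_rpow_enorm_toReal two_ne_zero (by norm_num), ENNReal.toReal_ofNat]
    have h2 : ∫⁻ x, ‖Sᶜ.indicator u x‖ₑ ^ (2 : ℝ) ∂μ ≤ A ^ (2 : ℝ) := by
      calc _ ≤ ∫⁻ x, A ^ (2 - r) * ‖u x‖ₑ ^ r ∂μ := by
            refine lintegral_mono fun x => ?_
            by_cases hx : x ∈ S
            · simp [hx]
            · rw [Set.indicator_of_mem (by exact hx)]
              have hx' : ‖u x‖ₑ ≤ A := not_lt.mp hx
              calc ‖u x‖ₑ ^ (2 : ℝ) = ‖u x‖ₑ ^ (2 - r) * ‖u x‖ₑ ^ r := by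
                    rw [← ENNReal.rpow_add_of_nonneg _ _ (by linarith) (by linarith)]
                    simp
                _ ≤ _ := by gcongr
        _ = A ^ (2 - r) * A ^ r := by
            rw [lintegral_const_mul _ (hu.enorm.pow_const r), hAp]
        _ = A ^ (2 : ℝ) := by
            rw [← ENNReal.rpow_add_of_nonneg _ _ (by linarith) (by linarith)]
            simp
    calc _ ≤ (A ^ (2 : ℝ)) ^ (1 / (2 : ℝ)) := by gcongr
      _ = A := by rw [← ENNReal.rpow_mul]; norm_num

section Fourier

open FourierTransform Laplacian SchwartzMap

variable {V : Type*} [NormedAddCommGroup V] [InnerProductSpace ℝ V] [FiniteDimensional ℝ V]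
  [MeasurableSpace V] [BorelSpace V]

lemma continuous_fourierInv {u : V → ℂ} (hu : Integrable u) : Continuous (𝓕⁻ u) := by
  have : Continuous (𝓕 u) := VectorFourier.fourierIntegral_continuous Real.continuous_fourierChar
    (innerSL ℝ).continuous₂ hu
  have h2 : 𝓕⁻ u = fun x => 𝓕 u (-x) := funext fun x => Real.fourierInv_eq_fourier_neg u x
  rw [h2]
  exact this.comp continuous_neg

lemma integral_schwartz_mul_fourierInv {u : V → ℂ} (hu : Integrable u) (φ : 𝓢(V, ℂ)) :
    ∫ ξ, φ ξ * 𝓕⁻ u ξ = ∫ x, (𝓕⁻ φ) x * u x := by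
  have h := VectorFourier.integral_fourierIntegral_smul_eq_flip (μ := (volume : Measure V))
    (ν := (volume : Measure V)) (L := -innerₗ V) (f := ⇑φ) (g := u)
    Real.continuous_fourierChar (continuous_inner.neg) φ.integrable hu
  have hflip : (-innerₗ V).flip = -innerₗ V := by
    ext x y; simp [real_inner_comm]
  rw [hflip] at h
  rw [fourierInv_coe]
  exact h.symm

lemma integral_schwartz_mul_fourier {u : V → ℂ} (hu : Integrable u) (φ : 𝓢(V, ℂ)) :
    ∫ ξ, φ ξ * 𝓕 u ξ = ∫ x, (𝓕 φ) x * u x := by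
  have h := VectorFourier.integral_fourierIntegral_smul_eq_flip (μ := (volume : Measure V))
    (ν := (volume : Measure V)) (L := innerₗ V) (f := ⇑φ) (g := u)
    Real.continuous_fourierChar continuous_inner φ.integrable hu
  rw [flip_innerₗ] at h
  exact h.symm

/-- The (distributional) inverse Fourier transform of a function in `L^p`, `1 ≤ p ≤ 2`, is the sum
of a bounded continuous function and a square-integrable one. -/
theorem exists_fourierInv_of_memLp {u : V → ℂ} (hu : StronglyMeasurable u) {p : ℝ≥0∞}
    (hp1 : 1 ≤ p) (hp2 : p ≤ 2) (hup : MemLp u p volume) :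
    ∃ h₁ h₂ : V → ℂ, Continuous h₁ ∧ (∀ ξ, ‖h₁ ξ‖ₑ ≤ eLpNorm u p volume) ∧ MemLp h₂ 2 volume ∧
      eLpNorm h₂ 2 volume ≤ eLpNorm u p volume ∧
      ∀ φ : 𝓢(V, ℂ), ∫ ξ, φ ξ * (h₁ ξ + h₂ ξ) = ∫ x, (𝓕⁻ φ) x * u x := by
  obtain ⟨u₁, u₂, hadd, hm₁, hm₂, hn₁, hn₂⟩ := exists_add_eq_of_memLp hu hp1 hp2 hup
  have hu₁ : MemLp u₁ 1 volume := ⟨hm₁, hn₁.trans_lt hup.2⟩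
  have hu₂ : MemLp u₂ 2 volume := ⟨hm₂, hn₂.trans_lt hup.2⟩
  have hi₁ : Integrable u₁ := memLp_one_iff_integrable.mp hu₁
  -- The `L²` part is transformed by Plancherel rather than by the integral, so its pairing with
  -- Schwartz functions is read off from the tempered-distribution transform.
  set g : Lp ℂ 2 (volume : Measure V) := 𝓕⁻ (hu₂.toLp u₂) with hg
  have hc : Continuous (𝓕⁻ u₁) := continuous_fourierInv hi₁
  have hb : ∀ ξ, ‖𝓕⁻ u₁ ξ‖ₑ ≤ eLpNorm u p volume := fun ξ => by
    rw [Real.fourierInv_eq]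
    refine (enorm_integral_le_lintegral_enorm _).trans ?_
    refine le_trans (le_of_eq ?_) (eLpNorm_one_eq_lintegral_enorm.symm.le.trans hn₁)
    refine lintegral_congr fun x => ?_
    rw [← ofReal_norm, ← ofReal_norm, Circle.norm_smul]
  have hgn : eLpNorm g 2 volume ≤ eLpNorm u p volume := by
    have h1 : ‖g‖ = ‖hu₂.toLp u₂‖ := by
      rw [← Lp.norm_fourier_eq g, hg, FourierTransform.fourier_fourierInv_eq]
    have h2 : eLpNorm g 2 volume = eLpNorm u₂ 2 volume := by
      rw [← Lp.enorm_def, ← eLpNorm_congr_ae hu₂.coeFn_toLp, ← Lp.enorm_def, ← ofReal_norm,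
        ← ofReal_norm, h1]
    exact h2.le.trans hn₂
  refine ⟨𝓕⁻ u₁, g, hc, hb, Lp.memLp g, hgn, fun φ => ?_⟩
  have hT : ∫ ξ, φ ξ * g ξ = ∫ x, (𝓕⁻ φ) x * u₂ x := by
    have h1 := congrArg (fun T => T φ) (Lp.fourierInv_toTemperedDistribution_eq (hu₂.toLp u₂))
    simp only [TemperedDistribution.fourierInv_apply, Lp.toTemperedDistribution_apply] at h1
    rw [← hg] at h1
    refine (h1.symm.trans ?_)
    refine integral_congr_ae ?_
    filter_upwards [hu₂.coeFn_toLp] with x hx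
    rw [hx, smul_eq_mul]
  have hbt : MemLp (𝓕⁻ u₁) ⊤ volume :=
    ⟨hc.aestronglyMeasurable, (eLpNormEssSup_le_of_ae_enorm_bound
      (Filter.Eventually.of_forall hb)).trans_lt hup.2⟩
  have e1 : Integrable fun ξ => φ ξ * 𝓕⁻ u₁ ξ := (φ.memLp 1 volume).integrable_mul hbt
  have e2 : Integrable fun ξ => φ ξ * g ξ := (φ.memLp 2 volume).integrable_mul (Lp.memLp g)
  have e3 : Integrable fun x => (𝓕⁻ φ) x * u₁ x :=
    ((𝓕⁻ φ).memLp ⊤ volume).integrable_mul hu₁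
  have e4 : Integrable fun x => (𝓕⁻ φ) x * u₂ x :=
    ((𝓕⁻ φ).memLp 2 volume).integrable_mul hu₂
  simp only [mul_add, hadd]
  rw [integral_add e1 e2, integral_add e3 e4, hT, integral_schwartz_mul_fourierInv hi₁]

lemma laplacian_fourierInv_schwartz (φ : 𝓢(V, ℂ)) :
    Δ (𝓕⁻ φ) = 𝓕⁻ (-(2 * Real.pi) ^ 2 • smulLeftCLM ℂ (fun ξ : V => ‖ξ‖ ^ 2) φ) := by
  rw [SchwartzMap.laplacian_eq_fourierMultiplierCLM, fourierMultiplierCLM_apply,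
    FourierTransform.fourier_fourierInv_eq]
  ext x
  simp only [smul_apply, fourierInv_coe]
  rw [Real.fourierInv_eq, Real.fourierInv_eq, ← integral_smul]
  refine integral_congr_ae (Filter.Eventually.of_forall fun ξ => ?_)
  exact smul_comm _ _ _

/-- Two locally integrable functions with equal integrals against Schwartz functions agree. -/
lemma ae_eq_of_integral_schwartz_mul_eq {h h' : V → ℂ} (hh : LocallyIntegrable h)
    (hh' : LocallyIntegrable h') (heq : ∀ φ : 𝓢(V, ℂ), ∫ ξ, φ ξ * h ξ = ∫ ξ, φ ξ * h' ξ) :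
    h =ᵐ[volume] h' := by
  refine ae_eq_of_integral_contDiff_smul_eq hh hh' fun g hg hgs => ?_
  have hgs' : HasCompactSupport fun x => (g x : ℂ) := hgs.comp_left (g := Complex.ofReal) (by simp)
  have hg' : ContDiff ℝ ∞ fun x => (g x : ℂ) := Complex.ofRealCLM.contDiff.comp hg
  simpa using heq (hgs'.toSchwartzMap hg')

end Fourier

/-! ### The Laplacian as a multiplier on the Fourier side -/

section FourierLaplacian

open FourierTransform Laplacian SchwartzMap

variable {n : ℕ}

local notation "E" => EuclideanSpace ℝ (Fin n)

/-- Testing against `φ` moves `Δ` from `u` onto `𝓕⁻ φ`, where it turns into multiplication of `φ` by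
`-(2π‖ξ‖)²`. -/
lemma ae_eq_of_fourierInv_laplacian {u : E → ℂ} (hu : ContDiff ℝ ∞ u) {p : ℝ≥0∞} (hp : 1 ≤ p)
    (hup : MemLp u p volume) (hLup : MemLp (laplacian u) p volume) {h h' : E → ℂ}
    (hh : LocallyIntegrable h) (hh' : LocallyIntegrable h')
    (hF : ∀ φ : 𝓢(E, ℂ), ∫ ξ, φ ξ * h ξ = ∫ x, (𝓕⁻ φ) x * u x)
    (hF' : ∀ φ : 𝓢(E, ℂ), ∫ ξ, φ ξ * h' ξ = ∫ x, (𝓕⁻ φ) x * laplacian u x) :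
    h' =ᵐ[volume] fun ξ => -((2 * Real.pi * ‖ξ‖ : ℝ) : ℂ) ^ 2 * h ξ := by
  refine ae_eq_of_integral_schwartz_mul_eq hh' ?_ fun φ => ?_
  · have hc : Continuous fun ξ : E => -((2 * Real.pi * ‖ξ‖ : ℝ) : ℂ) ^ 2 := by fun_prop
    exact hh.continuous_smul hc
  · have h1 := integral_laplacian_mul_schwartz hu hp hup hLup (𝓕⁻ φ)
    have h2 := hF (-(2 * Real.pi) ^ 2 • smulLeftCLM ℂ (fun ξ : E => ‖ξ‖ ^ 2) φ)
    rw [← laplacian_fourierInv_schwartz] at h2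
    rw [hF']
    simp only [mul_comm (laplacian u _), mul_comm (u _)] at h1
    rw [h1, ← h2]
    refine integral_congr_ae (Filter.Eventually.of_forall fun ξ => ?_)
    simp only [smul_apply, smulLeftCLM_apply_apply (Function.hasTemperateGrowth_norm_sq E)]
    simp only [Complex.real_smul]
    push_cast
    ring

end FourierLaplacian

/-! ### Moments of the Fourier transform -/

section Moments

open FourierTransform SchwartzMap

/-- With `s = 2πr`, one has `1 + r ≤ 2 max(1, s)`. This trades `q` surplus powers for the decaying
weight that makes the moments converge. -/
lemma pow_le_weight_mul {r : ℝ} (hr : 0 ≤ r) {j q m : ℕ} (hjm : j + q ≤ m) :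
    (2 * Real.pi * r) ^ j ≤
      2 ^ q * ((1 + r) ^ q)⁻¹ * (1 + (2 * Real.pi * r) ^ m) := by
  set s := 2 * Real.pi * r with hs
  have hrs : r ≤ s := by
    have := Real.pi_gt_three
    rw [hs]; nlinarith
  have hs0 : 0 ≤ s := hr.trans hrs
  clear_value s
  have hpos : 0 < (1 + r) ^ q := by positivity
  rw [mul_right_comm, ← div_eq_mul_inv, le_div_iff₀ hpos]
  rcases le_total s 1 with h1 | h1
  · calc s ^ j * (1 + r) ^ q ≤ 1 * 2 ^ q := by
          gcongr
          · exact pow_le_one₀ hs0 h1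
          · linarith
      _ ≤ 2 ^ q * (1 + s ^ m) := by
          rw [one_mul]
          exact le_mul_of_one_le_right (by positivity) (by simpa using pow_nonneg hs0 m)
  · calc s ^ j * (1 + r) ^ q ≤ s ^ j * (2 * s) ^ q := by
          gcongr
          linarith
      _ = 2 ^ q * s ^ (j + q) := by rw [mul_pow, pow_add]; ring
      _ ≤ 2 ^ q * (1 + s ^ m) := by
          gcongr
          exact (pow_le_pow_right₀ h1 hjm).trans (by linarith)

variable {n : ℕ}

local notation "E" => EuclideanSpace ℝ (Fin n)

/-- The weight `K` is integrable since `2(n+1) > n`, which handles the bounded part; Cauchy–Schwarz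
with `K² ≤ K` handles the `L²` part. An even exponent suits the even powers produced by `Δ^m`. -/
lemma exists_lintegral_weight_le (n : ℕ) : ∃ C : ℝ≥0∞, C ≠ ⊤ ∧
    ∀ (A : ℝ≥0∞) (h₁ h₂ : EuclideanSpace ℝ (Fin n) → ℂ), (∀ ξ, ‖h₁ ξ‖ₑ ≤ A) →
      AEStronglyMeasurable h₂ volume → eLpNorm h₂ 2 volume ≤ A →
      ∫⁻ ξ, ENNReal.ofReal (((1 + ‖ξ‖) ^ (2 * (n + 1)))⁻¹) * ‖h₁ ξ + h₂ ξ‖ₑ ≤ C * A := by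
  set K : EuclideanSpace ℝ (Fin n) → ℝ≥0∞ :=
    fun ξ => ENNReal.ofReal (((1 + ‖ξ‖) ^ (2 * (n + 1)))⁻¹) with hK
  have hKm : Measurable K := by fun_prop
  have hK1 : ∀ ξ, K ξ ≤ 1 := fun ξ => by
    rw [hK, ENNReal.ofReal_le_one]
    exact inv_le_one_of_one_le₀ (one_le_pow₀ (by linarith [norm_nonneg ξ]))
  have hKi : ∫⁻ ξ, K ξ ≠ ⊤ := by
    have h1 : Integrable (fun ξ : EuclideanSpace ℝ (Fin n) =>
        (1 + ‖ξ‖) ^ (-((2 * (n + 1) : ℕ) : ℝ))) := by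
      refine integrable_one_add_norm ?_
      rw [finrank_euclideanSpace_fin]
      exact_mod_cast (by omega : n < 2 * (n + 1))
    have h2 : (fun ξ : EuclideanSpace ℝ (Fin n) => (1 + ‖ξ‖) ^ (-((2 * (n + 1) : ℕ) : ℝ))) =
        fun ξ => ((1 + ‖ξ‖) ^ (2 * (n + 1)))⁻¹ := by
      ext ξ
      rw [Real.rpow_neg (by positivity), Real.rpow_natCast]
    rw [h2] at h1
    exact h1.lintegral_lt_top.ne
  refine ⟨(∫⁻ ξ, K ξ) + (∫⁻ ξ, K ξ) ^ (1 / (2 : ℝ)), ?_, fun A h₁ h₂ hb hm hn => ?_⟩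
  · exact ENNReal.add_ne_top.mpr ⟨hKi, ENNReal.rpow_ne_top_of_nonneg (by norm_num) hKi⟩
  calc ∫⁻ ξ, K ξ * ‖h₁ ξ + h₂ ξ‖ₑ ≤ ∫⁻ ξ, (K ξ * A + K ξ * ‖h₂ ξ‖ₑ) := by
        refine lintegral_mono fun ξ => ?_
        rw [← mul_add]
        gcongr
        exact (enorm_add_le _ _).trans (by gcongr; exact hb ξ)
    _ = (∫⁻ ξ, K ξ) * A + ∫⁻ ξ, (K * fun ξ => ‖h₂ ξ‖ₑ) ξ := by
        rw [lintegral_add_left (hKm.mul_const A), lintegral_mul_const _ hKm]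
        rfl
    _ ≤ (∫⁻ ξ, K ξ) * A + (∫⁻ ξ, K ξ) ^ (1 / (2 : ℝ)) * A := by
        gcongr
        refine (ENNReal.lintegral_mul_le_Lp_mul_Lq volume Real.HolderConjugate.two_two
          hKm.aemeasurable hm.enorm).trans ?_
        have h3 : (∫⁻ ξ, ‖h₂ ξ‖ₑ ^ (2 : ℝ)) ^ (1 / (2 : ℝ)) = eLpNorm h₂ 2 volume := by
          rw [eLpNorm_eq_lintegral_rpow_enorm_toReal two_ne_zero (by norm_num),
            ENNReal.toReal_ofNat]
        rw [h3]
        gcongr with ξ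
        calc K ξ ^ (2 : ℝ) = K ξ * K ξ := by rw [ENNReal.rpow_ofNat, sq]
          _ ≤ K ξ * 1 := by gcongr; exact hK1 ξ
          _ = K ξ := mul_one _
    _ = _ := by rw [add_mul]

/-- A smooth function all of whose iterated Laplacians are in `L^p`, `1 ≤ p ≤ 2`, is the Fourier
transform of a function all of whose moments are controlled by the norms of the Laplacians. -/
theorem exists_fourier_eq_and_moments_le {f : E → ℂ} (hf : ContDiff ℝ ∞ f) {p : ℝ≥0∞}
    (hp1 : 1 ≤ p) (hp2 : p ≤ 2) (hLp : ∀ m : ℕ, MemLp (Laplacian.laplacian^[m] f) p volume) :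
    ∃ (h : E → ℂ) (D : ℝ≥0∞), AEStronglyMeasurable h volume ∧ D ≠ ⊤ ∧
      (∀ j m : ℕ, j + 2 * (n + 1) ≤ 2 * m →
        ∫⁻ ξ, ENNReal.ofReal ((2 * Real.pi * ‖ξ‖) ^ j) * ‖h ξ‖ₑ ≤
          D * (eLpNorm f p volume + eLpNorm (Laplacian.laplacian^[m] f) p volume)) ∧
      f = 𝓕 h := by
  have hsm : ∀ m : ℕ, ContDiff ℝ ∞ (Laplacian.laplacian^[m] f) := fun m => by
    induction m with
    | zero => exact hf
    | succ m ih => rw [Function.iterate_succ_apply']; exact ih.laplacian_euclidean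
  choose h₁ h₂ hc hb hm hn hF using fun m =>
    exists_fourierInv_of_memLp (hsm m).continuous.stronglyMeasurable hp1 hp2 (hLp m)
  obtain ⟨C, hC, hCb⟩ := exists_lintegral_weight_le n
  set H : ℕ → E → ℂ := fun m ξ => h₁ m ξ + h₂ m ξ with hH
  have hloc : ∀ m, LocallyIntegrable (H m) := fun m =>
    (hc m).locallyIntegrable.add ((hm m).locallyIntegrable one_le_two)
  have hrec : ∀ m, H (m + 1) =ᵐ[volume]
      fun ξ => -((2 * Real.pi * ‖ξ‖ : ℝ) : ℂ) ^ 2 * H m ξ := fun m => by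
    have h1 := hLp (m + 1)
    have h2 := hF (m + 1)
    rw [Function.iterate_succ_apply'] at h1 h2
    exact ae_eq_of_fourierInv_laplacian (hsm m) hp1 (hLp m) h1 (hloc m) (hloc (m + 1)) (hF m) h2
  have hnorm : ∀ m, ∀ᵐ ξ, ‖H m ξ‖ = (2 * Real.pi * ‖ξ‖) ^ (2 * m) * ‖H 0 ξ‖ := fun m => by
    induction m with
    | zero => simp
    | succ m ih =>
      filter_upwards [ih, hrec m] with ξ h1 h2
      rw [h2, norm_mul, h1, norm_neg, norm_pow, Complex.norm_real, Real.norm_of_nonneg (by positivity)]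
      ring
  have hmeas : AEStronglyMeasurable (H 0) volume := (hloc 0).aestronglyMeasurable
  have hmom : ∀ j m : ℕ, j + 2 * (n + 1) ≤ 2 * m →
      ∫⁻ ξ, ENNReal.ofReal ((2 * Real.pi * ‖ξ‖) ^ j) * ‖H 0 ξ‖ₑ ≤
        (ENNReal.ofReal (2 ^ (2 * (n + 1))) * C) *
          (eLpNorm f p volume + eLpNorm (Laplacian.laplacian^[m] f) p volume) := by
    intro j m hjm
    have hK : Measurable fun ξ : E => ENNReal.ofReal (((1 + ‖ξ‖) ^ (2 * (n + 1)))⁻¹) := by fun_prop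
    calc _ ≤ ∫⁻ ξ, ENNReal.ofReal (2 ^ (2 * (n + 1))) *
          (ENNReal.ofReal (((1 + ‖ξ‖) ^ (2 * (n + 1)))⁻¹) * ‖H 0 ξ‖ₑ +
            ENNReal.ofReal (((1 + ‖ξ‖) ^ (2 * (n + 1)))⁻¹) * ‖H m ξ‖ₑ) := by
          refine lintegral_mono_ae ?_
          filter_upwards [hnorm m] with ξ hξ
          rw [← ofReal_norm, ← ofReal_norm, hξ, ← ENNReal.ofReal_mul (by positivity),
            ← ENNReal.ofReal_mul (by positivity), ← ENNReal.ofReal_mul (by positivity),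
            ← ENNReal.ofReal_add (by positivity) (by positivity),
            ← ENNReal.ofReal_mul (by positivity)]
          refine ENNReal.ofReal_le_ofReal ?_
          calc _ ≤ 2 ^ (2 * (n + 1)) * ((1 + ‖ξ‖) ^ (2 * (n + 1)))⁻¹ *
                (1 + (2 * Real.pi * ‖ξ‖) ^ (2 * m)) * ‖H 0 ξ‖ := by
                gcongr
                exact pow_le_weight_mul (norm_nonneg ξ) hjm
            _ = _ := by ring
      _ ≤ ENNReal.ofReal (2 ^ (2 * (n + 1))) * (C * eLpNorm f p volume +
            C * eLpNorm (Laplacian.laplacian^[m] f) p volume) := by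
          have hKH : AEMeasurable fun ξ : E =>
              ENNReal.ofReal (((1 + ‖ξ‖) ^ (2 * (n + 1)))⁻¹) * ‖H 0 ξ‖ₑ :=
            hK.aemeasurable.mul hmeas.enorm
          rw [lintegral_const_mul' _ _ ENNReal.ofReal_ne_top, lintegral_add_left' hKH]
          gcongr
          · exact hCb _ _ _ (hb 0) (hm 0).1 (hn 0)
          · exact hCb _ _ _ (hb m) (hm m).1 (hn m)
      _ = _ := by ring
  have hint : Integrable (H 0) := by
    refine ⟨hmeas, ?_⟩
    have h1 := hmom 0 (n + 1) (by omega)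
    simp only [pow_zero, ENNReal.ofReal_one, one_mul] at h1
    refine h1.trans_lt (ENNReal.mul_lt_top (ENNReal.mul_lt_top ENNReal.ofReal_lt_top hC.lt_top)
      (ENNReal.add_lt_top.mpr ⟨(hLp 0).2, (hLp _).2⟩))
  refine ⟨H 0, _, hmeas, ENNReal.mul_ne_top ENNReal.ofReal_ne_top hC, hmom, ?_⟩
  have hcont : Continuous (𝓕 (H 0)) := VectorFourier.fourierIntegral_continuous
    Real.continuous_fourierChar (innerSL ℝ).continuous₂ hint
  refine (Continuous.ae_eq_iff_eq volume hf.continuous hcont).mp ?_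
  -- Fourier inversion by duality: `∫ φ 𝓕h = ∫ (𝓕φ) h = ∫ (𝓕⁻𝓕φ) f = ∫ φ f`. Continuity of both
  -- sides then upgrades almost everywhere equality to equality.
  refine ae_eq_of_integral_schwartz_mul_eq hf.continuous.locallyIntegrable
    hcont.locallyIntegrable fun φ => ?_
  rw [integral_schwartz_mul_fourier hint, hF 0 (𝓕 φ), FourierTransform.fourierInv_fourier_eq]
  rfl

end Moments

/-! ### Derivative bounds from moments, restriction to lines, and the conclusion -/

section Main

open FourierTransform

/-- Differentiating under the integral brings down one factor `-2πi⟨ξ, ·⟩` per derivative, of norm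
at most `2π‖ξ‖`. -/
lemma norm_iteratedFDeriv_fourier_le {V : Type*} [NormedAddCommGroup V] [InnerProductSpace ℝ V]
    [FiniteDimensional ℝ V] [MeasurableSpace V] [BorelSpace V] {h : V → ℂ}
    (hm : AEStronglyMeasurable h volume)
    (hi : ∀ j : ℕ, Integrable (fun ξ => (2 * Real.pi * ‖ξ‖) ^ j * ‖h ξ‖)) (j : ℕ) (x : V) :
    ‖iteratedFDeriv ℝ j (𝓕 h) x‖ ≤ ∫ ξ, (2 * Real.pi * ‖ξ‖) ^ j * ‖h ξ‖ := by
  have hi' : ∀ k : ℕ, (k : ℕ∞) ≤ ⊤ → Integrable (fun ξ => ‖ξ‖ ^ k * ‖h ξ‖) := fun k _ => by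
    refine ((hi k).const_mul (((2 * Real.pi) ^ k)⁻¹)).congr (Filter.Eventually.of_forall fun ξ => ?_)
    have := Real.pi_pos
    simp only [mul_pow]
    field_simp
  rw [Real.iteratedFDeriv_fourier hi' hm le_top]
  refine (VectorFourier.norm_fourierIntegral_le_integral_norm _ _ _ _ _).trans ?_
  refine integral_mono_of_nonneg (Filter.Eventually.of_forall fun _ => norm_nonneg _) (hi j)
    (Filter.Eventually.of_forall fun ξ => ?_)
  refine (VectorFourier.norm_fourierPowSMulRight_le _ _ _ _).trans ?_
  beta_reduce
  rw [mul_pow (2 * Real.pi) ‖ξ‖]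
  have := Real.pi_pos
  have hL : 2 * Real.pi * ‖innerSL ℝ (E := V)‖ ≤ 2 * Real.pi :=
    mul_le_of_le_one_right (by positivity) (norm_innerSL_le ℝ)
  exact mul_le_mul_of_nonneg_right (mul_le_mul_of_nonneg_right
    (pow_le_pow_left₀ (by positivity) hL j) (by positivity)) (norm_nonneg _)

/-- Derivatives along a line. -/
lemma iteratedDeriv_comp_line {V : Type*} [NormedAddCommGroup V] [NormedSpace ℝ V] {f : V → ℂ}
    (hf : ContDiff ℝ ∞ f) (x₀ v : V) (j : ℕ) (t : ℝ) :
    iteratedDeriv j (fun s : ℝ => f (x₀ + s • v)) t =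
      iteratedFDeriv ℝ j f (x₀ + t • v) (fun _ => v) := by
  have h1 : (fun s : ℝ => f (x₀ + s • v)) =
      (fun y => f (x₀ + y)) ∘ (ContinuousLinearMap.toSpanSingleton ℝ v) := by
    ext s; simp
  have h2 : ContDiff ℝ ∞ fun y => f (x₀ + y) := hf.comp (contDiff_const.add contDiff_id)
  rw [iteratedDeriv_eq_iteratedFDeriv, h1,
    ContinuousLinearMap.iteratedFDeriv_comp_right _ h2 t (by exact_mod_cast le_top),
    iteratedFDeriv_comp_add_left]
  simp

/-- The moments of a nonnegative weight, increased by one, form a log-convex sequence. -/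
lemma one_add_moment_sq_le {α : Type*} [MeasurableSpace α] {μ : Measure α} {s w : α → ℝ}
    (hw : ∀ x, 0 ≤ w x) (hs : ∀ x, 0 ≤ s x) (hi : ∀ j : ℕ, Integrable (fun x => s x ^ j * w x) μ)
    (j : ℕ) :
    (1 + ∫ x, s x ^ (j + 1) * w x ∂μ) ^ 2 ≤
      (1 + ∫ x, s x ^ j * w x ∂μ) * (1 + ∫ x, s x ^ (j + 2) * w x ∂μ) := by
  -- The quadratic equals `(1 - t)² + ∫ s^j (s - t)² w`, so its discriminant is nonpositive. The
  -- added ones act as a unit point mass at `s = 1`.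
  have key : ∀ t : ℝ, 0 ≤ (1 + ∫ x, s x ^ j * w x ∂μ) * (t * t) +
      (-2 * (1 + ∫ x, s x ^ (j + 1) * w x ∂μ)) * t + (1 + ∫ x, s x ^ (j + 2) * w x ∂μ) := by
    intro t
    have h1 : 0 ≤ ∫ x, s x ^ j * (s x - t) ^ 2 * w x ∂μ := integral_nonneg fun x =>
      mul_nonneg (mul_nonneg (pow_nonneg (hs x) _) (sq_nonneg _)) (hw x)
    have h2 : ∫ x, s x ^ j * (s x - t) ^ 2 * w x ∂μ =
        ∫ x, s x ^ (j + 2) * w x ∂μ - 2 * t * ∫ x, s x ^ (j + 1) * w x ∂μ +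
          t ^ 2 * ∫ x, s x ^ j * w x ∂μ := by
      have h3 : Integrable (fun x => s x ^ (j + 2) * w x - 2 * t * (s x ^ (j + 1) * w x)) μ :=
        (hi _).sub ((hi _).const_mul _)
      rw [← integral_const_mul, ← integral_const_mul, ← integral_sub (hi _) ((hi _).const_mul _),
        ← integral_add h3 ((hi _).const_mul _)]
      refine integral_congr_ae (Filter.Eventually.of_forall fun x => ?_)
      simp only
      ring
    rw [h2] at h1
    nlinarith [sq_nonneg (1 - t)]
  have := discrim_le_zero key
  rw [discrim] at this
  nlinarith

end Main

theorem theorem1p3 (n : ℕ) (f : EuclideanSpace ℝ (Fin n) → ℂ) (hf : ContDiff ℝ ∞ f)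
    (p : ℝ≥0∞) (hp1 : 1 ≤ p) (hp2 : p ≤ 2)
    (hLp : ∀ m : ℕ, MemLp (Laplacian.laplacian^[m] f) p volume)
    (hsum : ∑' m : ℕ,
      eLpNorm (Laplacian.laplacian^[m + 1] f) p volume ^ (-(1 / (2 * ((m : ℝ) + 1)))) = (⊤ : ℝ≥0∞))
    (hvanish : ∃ x₀ : EuclideanSpace ℝ (Fin n),
      ∀ α : Fin n → ℕ, multiPartialDeriv α f x₀ = 0) :
    ∀ x : EuclideanSpace ℝ (Fin n), f x = 0 := by
  obtain ⟨x₀, hx₀⟩ := hvanish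
  obtain ⟨h, D, hm, hD, hmom, hfh⟩ := exists_fourier_eq_and_moments_le hf hp1 hp2 hLp
  set a : ℕ → ℝ≥0∞ := fun m => eLpNorm (Laplacian.laplacian^[m] f) p volume with ha
  have hat : ∀ m, a m ≠ ⊤ := fun m => (hLp m).2.ne
  have hpos : ∀ ξ : EuclideanSpace ℝ (Fin n), 0 ≤ 2 * Real.pi * ‖ξ‖ := fun ξ => by positivity
  have hlin : ∀ j, ∫⁻ ξ, ‖(2 * Real.pi * ‖ξ‖) ^ j * ‖h ξ‖‖ₑ =
      ∫⁻ ξ, ENNReal.ofReal ((2 * Real.pi * ‖ξ‖) ^ j) * ‖h ξ‖ₑ := fun j => by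
    refine lintegral_congr fun ξ => ?_
    rw [enorm_mul, enorm_norm, Real.enorm_of_nonneg (pow_nonneg (hpos ξ) j)]
  have hi : ∀ j : ℕ, Integrable (fun ξ => (2 * Real.pi * ‖ξ‖) ^ j * ‖h ξ‖) := fun j => by
    have hc : Continuous fun ξ : EuclideanSpace ℝ (Fin n) => (2 * Real.pi * ‖ξ‖) ^ j := by fun_prop
    refine ⟨hc.aestronglyMeasurable.mul hm.norm, ?_⟩
    rw [hasFiniteIntegral_iff_enorm, hlin]
    exact (hmom j (j + (n + 1)) (by omega)).trans_lt (ENNReal.mul_lt_top hD.lt_top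
      (ENNReal.add_lt_top.mpr ⟨(hLp 0).2, (hLp _).2⟩))
  set M : ℕ → ℝ := fun j => 1 + ∫ ξ, (2 * Real.pi * ‖ξ‖) ^ j * ‖h ξ‖ with hMdef
  have hI0 : ∀ j, 0 ≤ ∫ ξ, (2 * Real.pi * ‖ξ‖) ^ j * ‖h ξ‖ := fun j =>
    integral_nonneg fun ξ => mul_nonneg (pow_nonneg (hpos ξ) j) (norm_nonneg _)
  have hM1 : ∀ j, 1 ≤ M j := fun j => le_add_of_nonneg_right (hI0 j)
  have hM : ∀ j, 0 < M j := fun j => one_pos.trans_le (hM1 j)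
  have hMle : ∀ j m, j + 2 * (n + 1) ≤ 2 * m →
      M j ≤ 1 + D.toReal * ((a 0).toReal + (a m).toReal) := by
    intro j m hjm
    have h1 := ENNReal.toReal_mono (ENNReal.mul_ne_top hD
      (ENNReal.add_ne_top.mpr ⟨hat 0, hat m⟩)) (hmom j m hjm)
    rw [ENNReal.toReal_mul, ENNReal.toReal_add (hat 0) (hat m), ← hlin,
      ← integral_norm_eq_lintegral_enorm (hi j).1] at h1
    have h2 : ∫ ξ, ‖(2 * Real.pi * ‖ξ‖) ^ j * ‖h ξ‖‖ = ∫ ξ, (2 * Real.pi * ‖ξ‖) ^ j * ‖h ξ‖ :=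
      integral_congr_ae (Filter.Eventually.of_forall fun ξ => Real.norm_of_nonneg
        (mul_nonneg (pow_nonneg (hpos ξ) j) (norm_nonneg _)))
    rw [h2] at h1
    exact add_le_add_right h1 1
  have hDa : 0 ≤ D.toReal * (a 0).toReal := by positivity
  have hC : 1 ≤ 1 + D.toReal * (a 0).toReal + D.toReal := by
    have : 0 ≤ D.toReal := ENNReal.toReal_nonneg
    linarith
  have hdiv : ¬ Summable fun j => M j / M (j + 1) := by
    intro hs
    -- If one norm vanishes, so do all later ones, and `M` is bounded at the even indices used. The
    -- comparison sequence is then the constant `1`, whose Carleman series diverges.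
    by_cases hz : ∃ m, a (m + 1) = 0
    · obtain ⟨m, hm0⟩ := hz
      have hzero : ∀ k, a (m + 1 + k) = 0 := by
        have hsm : ∀ m : ℕ, ContDiff ℝ ∞ (Laplacian.laplacian^[m] f) := fun m => by
          induction m with
          | zero => exact hf
          | succ m ih => rw [Function.iterate_succ_apply']; exact ih.laplacian_euclidean
        have h1 : Laplacian.laplacian^[m + 1] f = 0 := by
          refine (Continuous.ae_eq_iff_eq volume (hsm _).continuous continuous_const).mp ?_
          exact (eLpNorm_eq_zero_iff (hLp _).1 (one_pos.trans_le hp1).ne').mp hm0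
        have h2 : ∀ k, Laplacian.laplacian^[m + 1 + k] f = 0 := fun k => by
          induction k with
          | zero => exact h1
          | succ k ih =>
            rw [← add_assoc, Function.iterate_succ_apply', ih]
            exact InnerProductSpace.laplacian_const
        intro k
        simp only [ha, h2 k, eLpNorm_zero]
      refine tsum_rpow_neg_ne_top (a := fun _ => 1) (by simp) (by simp) hM (hM1 0) hC 0
        (fun i => ?_) hs (by simp)
      have h1 := hMle (2 * (i + 1)) (m + 1 + (i + 1 + (n + 1))) (by omega)
      rw [hzero] at h1
      have : 0 ≤ D.toReal := ENNReal.toReal_nonneg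
      simp only [ENNReal.toReal_zero, ENNReal.toReal_one, max_self, mul_one] at h1 ⊢
      linarith
    · push Not at hz
      -- The shift `n + 1` is the number of extra Laplacians that the moment estimate costs.
      refine tsum_rpow_neg_ne_top (a := fun i => a (i + 1)) hz (fun i => hat _) hM (hM1 0) hC
        (n + 1) (fun i => ?_) hs hsum
      have h1 := hMle (2 * (i + 1)) (i + (n + 1) + 1) (by omega)
      refine h1.trans ?_
      have h2 := le_max_left 1 (a (i + (n + 1) + 1)).toReal
      have h3 := le_max_right 1 (a (i + (n + 1) + 1)).toReal
      have h4 : 0 ≤ D.toReal := ENNReal.toReal_nonneg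
      nlinarith [mul_le_mul_of_nonneg_left h3 h4, mul_le_mul_of_nonneg_left h2 hDa]
  intro x
  by_cases hx : x = x₀
  · rw [hx, ← multiPartialDeriv_zero f]; exact hx₀ 0
  have hne : 0 < ‖x - x₀‖ := norm_pos_iff.mpr (sub_ne_zero.mpr hx)
  -- A unit direction keeps the derivative bounds `M j` free of factors `‖v‖ ^ j`; the point `x`
  -- sits at parameter `‖x - x₀‖`.
  set v : EuclideanSpace ℝ (Fin n) := ‖x - x₀‖⁻¹ • (x - x₀) with hv
  have hv1 : ‖v‖ = 1 := by
    rw [hv, norm_smul, norm_inv, norm_norm, inv_mul_cancel₀ hne.ne']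
  have hg : ContDiff ℝ ∞ fun t : ℝ => f (x₀ + t • v) :=
    hf.comp (contDiff_const.add (contDiff_id.smul contDiff_const))
  have hfin := eq_zero_of_norm_iteratedDeriv_le hg hM
    (one_add_moment_sq_le (fun ξ => norm_nonneg (h ξ)) hpos hi) (fun j t => ?_) hdiv (fun j => ?_)
    hne.le
  · rw [hv, smul_smul, mul_inv_cancel₀ hne.ne', one_smul, add_sub_cancel] at hfin
    exact hfin
  · rw [iteratedDeriv_comp_line hf]
    refine (ContinuousMultilinearMap.le_opNorm _ _).trans ?_
    simp only [hv1, Finset.prod_const_one, mul_one]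
    rw [hfh]
    refine (norm_iteratedFDeriv_fourier_le hm hi j _).trans ?_
    rw [hMdef]
    linarith
  · rw [iteratedDeriv_comp_line hf, zero_smul, add_zero,
      iteratedFDeriv_eq_zero_of_multiPartialDeriv hf hx₀]
    rfl
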